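/- Consider a master node with $N$ files and $K$ worker nodes, where $1\le K\le N$, $K\mid N$, the capacity $S$ of each worker's cache (in files) satisfies $N/K\le S\le N$, and $\widehat S=S/(N/K)\in\{1,\dots,K\}$ is an integer. Every file consists of $B\ge 1$ bits, where $B$ may be chosen by the scheme, and counts as one unit of size. An assignment is a partition of the set of files into $K$ sets of size $N/K$, one for each worker. Let $u$ be the current assignment. An (uncoded) cache placement stores at each worker $i$ a set of at most $SB$ bits of the files, among them all bits of the files in $u(i)$; it is chosen without knowledge of the next assignment. Given the next assignment $d$, the master broadcasts a message $\mathcal X$, a function of all files, such that each worker $i$ can decode all files in $d(i)$ from $\mathcal X$ and its cache, for all contents of the files. The load of a message with $q$ possible values is $\log_2(q)/B$. The worst-case load $R_{\text{worst-case}}$ is the minimum, over all $B$ and all cache placements, of the maximum over all assignments $d$ of the smallest load of a message that serves $d$. Then, for every $u$, $$R_{\text{worst-case}}=\frac NK\cdot\frac{\binom{K-1}{\widehat S}}{\binom{K-1}{\widehat S-1}}.$$ Moreover, (i) the same value is the smallest load that can be guaranteed in every one of infinitely many consecutive iterations, where the successive assignments are arbitrary and not known in advance, and where after each iteration every worker replaces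 its cache by an uncoded cache for its new assignment, of at most $SB$ bits, all of which it can decode from its old cache and the message; and (ii) the same value is the optimal load for the cyclic shuffle $d(i)=u(i+1)$ for $i<K$, $d(K)=u(1)$, that is, the minimum over all $B$ and all cache placements of the load averaged over all assignments $d$ whose file transition graph is isomorphic to that of the cyclic shuffle. (The file transition graph of $d$ is the directed multigraph on the workers with $|u(i)\cap d(\ell)|$ edges from $i$ to $\ell$.) -/

import Mathlib

/-! Data shuffling with `N` files, `K` worker nodes and caches of `S` files.  Every file consists of
`B` bits (one file is one unit of size); bit `b` of file `j` has the index `(j, b)`. -/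

namespace DataShuffling

/-- The contents of all `N` files. -/
abbrev Files (N B : ℕ) : Type := Fin N × Fin B → ZMod 2

/-- An assignment of the files to the workers: worker `i` processes the files in `u i`; each worker
gets `N / K` files and the sets `u i` partition the set of all files. -/
def IsAssignment {N K : ℕ} (u : Fin K → Finset (Fin N)) : Prop :=
  (∀ i, (u i).card = N / K) ∧ ∀ j, ∃! i, j ∈ u i

/-- The indices of all bits of the files in `J`. -/
def allBits {N : ℕ} (B : ℕ) (J : Finset (Fin N)) : Finset (Fin N × Fin B) :=
  J ×ˢ Finset.univ

/-- An uncoded cache placement for the current assignment `u`: worker `i` stores the bits of the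
files with indices in `Z i`, among them all bits of the files that it is processing, and at most
`S` files' worth of bits altogether. -/
def IsPlacement {N K B : ℕ} (S : ℕ) (u : Fin K → Finset (Fin N))
    (Z : Fin K → Finset (Fin N × Fin B)) : Prop :=
  ∀ i, allBits B (u i) ⊆ Z i ∧ (Z i).card ≤ S * B

/-- From the broadcast message `φ F` and the cached bits with indices in `C`, the bits with indices
in `T` can be decoded, whatever the contents `F` of the files are. -/
def CanDecode {N B q : ℕ} (φ : Files N B → Fin q) (C T : Finset (Fin N × Fin B)) : Prop :=
  ∃ ψ : Fin q → (C → ZMod 2) → (T → ZMod 2), ∀ F : Files N B, ψ (φ F) (C.restrict F) = T.restrict F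

/-- With the message `φ`, every worker can retrieve the files of its next assignment `d i`. -/
def Delivers {N K B q : ℕ} (φ : Files N B → Fin q) (Z : Fin K → Finset (Fin N × Fin B))
    (d : Fin K → Finset (Fin N)) : Prop :=
  ∀ i, CanDecode φ (Z i) (allBits B (d i))

/-- The size of a message with `q` possible values, in units of one file of `B` bits. -/
noncomputable def load (q B : ℕ) : ℝ := Real.logb 2 q / B

/-- For the current assignment `u` there is a cache placement, chosen without knowledge of the next
assignment, with which every next assignment `d` can be served by a message of load at most `R`. -/
def WorstCaseAchievable {N K : ℕ} (S : ℕ) (u : Fin K → Finset (Fin N)) (R : ℝ) : Prop :=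
  ∃ B : ℕ, 0 < B ∧ ∃ Z : Fin K → Finset (Fin N × Fin B), IsPlacement S u Z ∧
    ∀ d : Fin K → Finset (Fin N), IsAssignment d →
      ∃ (q : ℕ) (φ : Files N B → Fin q), Delivers φ Z d ∧ load q B ≤ R

/-- Load at most `R` in every one of infinitely many consecutive iterations, starting from the
assignment `u`, whatever the successive assignments are.  `A` is the set of the pairs (current
assignment, current caches) that may occur.  After each delivery, worker `i` replaces its cache
by bits that it can decode from its old cache and the message. -/
def PerpetuallyAchievable {N K : ℕ} (S : ℕ) (u : Fin K → Finset (Fin N)) (R : ℝ) : Prop :=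
  ∃ B : ℕ, 0 < B ∧
    ∃ A : Set ((Fin K → Finset (Fin N)) × (Fin K → Finset (Fin N × Fin B))),
      (∃ Z, (u, Z) ∈ A) ∧
      ∀ v Z, (v, Z) ∈ A → IsPlacement S v Z ∧
        ∀ d : Fin K → Finset (Fin N), IsAssignment d →
          ∃ (q : ℕ) (φ : Files N B → Fin q), Delivers φ Z d ∧ load q B ≤ R ∧
            ∃ Z', (d, Z') ∈ A ∧ ∀ i, CanDecode φ (Z i) (Z' i)

/-- The file transition graphs of `d` and `e` (current assignment `u`) are isomorphic.  The graph of
`d` is the directed multigraph on the workers with `(u i ∩ d l).card` edges from `i` to `l`. -/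
def SameTransitionGraph {N K : ℕ} (u d e : Fin K → Finset (Fin N)) : Prop :=
  ∃ σ : Equiv.Perm (Fin K), ∀ i l, (u i ∩ d l).card = (u (σ i) ∩ e (σ l)).card

open Classical in
/-- All assignments whose file transition graph is isomorphic to that of `e`. -/
noncomputable def graphClass {N K : ℕ} (u e : Fin K → Finset (Fin N)) :
    Finset (Fin K → Finset (Fin N)) :=
  Finset.univ.filter fun d => IsAssignment d ∧ SameTransitionGraph u d e

/-- For the current assignment `u` there is a cache placement with which the load, averaged over all
next assignments with the same file transition graph as `e` up to isomorphism, is at most `R`. -/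
def AverageAchievable {N K : ℕ} (S : ℕ) (u e : Fin K → Finset (Fin N)) (R : ℝ) : Prop :=
  ∃ B : ℕ, 0 < B ∧ ∃ Z : Fin K → Finset (Fin N × Fin B), IsPlacement S u Z ∧
    ∃ r : (Fin K → Finset (Fin N)) → ℝ,
      (∀ d ∈ graphClass u e,
        ∃ (q : ℕ) (φ : Files N B → Fin q), Delivers φ Z d ∧ load q B ≤ r d) ∧
      (∑ d ∈ graphClass u e, r d) / ((graphClass u e).card : ℝ) ≤ R

/-- The cyclic shuffle: worker `i` gets all the files that worker `i + 1` (cyclically) processes. -/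
def cyclicShuffle {N K : ℕ} (u : Fin K → Finset (Fin N)) : Fin K → Finset (Fin N) :=
  fun i => u (finRotate K i)

/-- The value `(N / K) * C(K - 1, s) / C(K - 1, s - 1)` with `s = S / (N / K)`. -/
noncomputable def optimalLoad (N K S : ℕ) : ℝ :=
  (N : ℝ) / K * ((K - 1).choose (S / (N / K)) : ℝ) / ((K - 1).choose (S / (N / K) - 1) : ℝ)

end DataShuffling

/-! Write `s` for the integer cache ratio and `m` for `N / K`. For the upper bound, split each file
into `(K - 1).choose (s - 1)` bits labelled by the `s`-sets of workers that contain its owner; a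
worker stores the bits whose label contains it. A file becomes a chain modulo 2 on the simplex of
workers. Split the files into `m` colours so that each worker receives at most one file of each
colour, and broadcast for each colour the sum of the boundaries of the cones over the file chains,
the apex being the next owner. This sum is a cycle, so its values on the `s`-sets avoiding one
vertex determine it: `(K - 1).choose s` bits per colour. Decoding rests on the homotopy identity
`boundary_cone_add_cone_boundary` (see `eq_zero_of_broadcastChain_eq_zero`). Exchanging old and new
owner in the labels restores the cache structure (`IsLabelling.exists_next`), so the scheme runs
forever.

For the lower bound, let the shuffle run along a cycle of workers in the order `τ`. The message and
the bits outside `neededBits` determine all files, block after block along the cycle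
(`two_pow_card_neededBits_le`). For random `τ`, a bit with `t` holders is needed with probability `1
/ t - 1 / K`; convexity of `1 / t` and the cache budget bound the mean from below by `m * B * (K -
s) / s` bits. Averaging over `τ` is averaging over the graph class (`sum_graphClass_div_card`).

Perpetual achievability implies worst-case achievability, which implies average achievability, so
these two bounds settle all three minima. -/

namespace DataShuffling

open Finset

/-! ### Chains modulo 2 on a simplex -/

section Boundary

variable {ι : Type*} [Fintype ι] [DecidableEq ι]

/-- The simplicial boundary operator modulo 2, on chains on the simplex with vertex set `ι`. -/
def boundary (c : Finset ι → ZMod 2) (D : Finset ι) : ZMod 2 :=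
  ∑ j ∈ Dᶜ, c (insert j D)

/-- The cone over a chain with apex `i`. -/
def cone (i : ι) (c : Finset ι → ZMod 2) (D : Finset ι) : ZMod 2 :=
  if i ∈ D then c (D.erase i) else 0

theorem boundary_sub (c e : Finset ι → ZMod 2) : boundary (c - e) = boundary c - boundary e := by
  ext D
  simp [boundary]

theorem cone_sub {κ : Type*} [DecidableEq κ] (i : κ) (c e : Finset κ → ZMod 2) : cone i (c - e) = cone i c - cone i e := by
  ext D
  by_cases h : i ∈ D <;> simp [cone, h]

theorem boundary_sum {α : Type*} (s : Finset α) (c : α → Finset ι → ZMod 2) :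
    boundary (∑ a ∈ s, c a) = ∑ a ∈ s, boundary (c a) := by
  ext D
  simp only [boundary, Finset.sum_apply]
  exact Finset.sum_comm

/-- The cone is a contracting homotopy of the simplex. Decoding uses it to trade the boundary of a
cone, which is broadcast, for the cone of a boundary, up to a coefficient that the decoding worker
has cached. -/
theorem boundary_cone_add_cone_boundary (i : ι) (c : Finset ι → ZMod 2) (D : Finset ι) :
    boundary (cone i c) D + cone i (boundary c) D = c D := by
  by_cases hi : i ∈ D
  · have h1 : boundary (cone i c) D = ∑ j ∈ Dᶜ, c (insert j (D.erase i)) := by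
      refine Finset.sum_congr rfl fun j hj => ?_
      have hji : j ≠ i := fun h => (mem_compl.1 hj) (h ▸ hi)
      rw [cone, if_pos (mem_insert_of_mem hi), erase_insert_of_ne hji]
    have h2 : (D.erase i)ᶜ = insert i Dᶜ := by
      ext j
      by_cases hj : j = i <;> simp [hj]
    have h3 : cone i (boundary c) D = c D + ∑ j ∈ Dᶜ, c (insert j (D.erase i)) := by
      rw [cone, if_pos hi, boundary, h2, sum_insert (by simpa using hi), insert_erase hi]
    rw [h1, h3, add_left_comm, CharTwo.add_self_eq_zero, add_zero]
  · rw [cone, if_neg hi, add_zero, boundary, Finset.sum_eq_single_of_mem i (mem_compl.2 hi)]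
    · rw [cone, if_pos (mem_insert_self _ _), erase_insert hi]
    · intro j _ hji
      rw [cone, if_neg]
      simp [hi, hji.symm]

theorem boundary_boundary (c : Finset ι → ZMod 2) : boundary (boundary c) = 0 := by
  ext D
  simp only [boundary, Finset.sum_sigma', Pi.zero_apply]
  -- Adding two vertices in either order gives the same simplex, so the terms cancel in pairs modulo
  -- 2.
  refine Finset.sum_involution (fun x _ => ⟨x.2, x.1⟩) ?_ ?_ ?_ ?_
  · rintro ⟨j, k⟩ _
    rw [Finset.insert_comm k j D]
    exact CharTwo.add_self_eq_zero _
  · rintro ⟨j, k⟩ h _ heq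
    simp only [mem_sigma, mem_compl, mem_insert, not_or] at h
    simp only [Sigma.mk.injEq] at heq
    exact h.2.1 heq.1
  · rintro ⟨j, k⟩ h
    simp only [mem_sigma, mem_compl, mem_insert, not_or] at h ⊢
    exact ⟨h.2.2, fun e => h.2.1 e.symm, h.1⟩
  · rintro ⟨j, k⟩ _
    rfl

/-- A cycle of dimension `s` that vanishes on the simplices avoiding one vertex is zero. -/
theorem eq_zero_of_boundary_eq_zero {c : Finset ι → ZMod 2} (hc : boundary c = 0) (k : ι) {s : ℕ}
    (h : ∀ D, D.card = s → k ∉ D → c D = 0) (D : Finset ι) (hD : D.card = s) : c D = 0 := by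
  by_cases hk : k ∈ D
  · have h0 : boundary c (D.erase k) = 0 := by rw [hc]; rfl
    rw [boundary, Finset.sum_eq_single_of_mem k (by simp), insert_erase hk] at h0
    · exact h0
    · intro j hj hjk
      have hjD : j ∉ D.erase k := mem_compl.1 hj
      refine h _ ?_ (by simp [hjk.symm])
      rw [card_insert_of_notMem hjD, card_erase_add_one hk, hD]
  · exact h D hD hk

theorem card_filter_superset {s : ℕ} (T : Finset ι) (hT : T.card ≤ s) :
    ((powersetCard s (univ : Finset ι)).filter fun A => T ⊆ A).card =
      (Fintype.card ι - T.card).choose (s - T.card) := by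
  rw [← card_compl, ← card_powersetCard]
  refine Finset.card_nbij' (fun A => A \ T) (fun A => A ∪ T) ?_ ?_ ?_ ?_
  · intro A hA
    simp only [mem_coe, mem_filter, mem_powersetCard, subset_univ, true_and] at hA ⊢
    refine ⟨fun x hx => mem_compl.2 (mem_sdiff.1 hx).2, ?_⟩
    rw [card_sdiff_of_subset hA.2, hA.1]
  · intro A hA
    simp only [mem_coe, mem_filter, mem_powersetCard, subset_univ, true_and] at hA ⊢
    have hd : Disjoint A T := disjoint_left.2 fun x hx => mem_compl.1 (hA.1 hx)
    refine ⟨?_, subset_union_right⟩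
    rw [card_union_of_disjoint hd, hA.2]
    omega
  · intro A hA
    simp only [mem_coe, mem_filter] at hA
    exact sdiff_union_of_subset hA.2
  · intro A hA
    simp only [mem_coe, mem_powersetCard] at hA
    exact union_sdiff_cancel_right (disjoint_left.2 fun x hx => mem_compl.1 (hA.1 hx))

end Boundary

/-! ### Decodability and owners -/

theorem canDecode_iff {N B q : ℕ} {φ : Files N B → Fin q} {C T : Finset (Fin N × Fin B)} :
    CanDecode φ C T ↔ ∀ F G : Files N B, φ F = φ G → (∀ x ∈ C, F x = G x) → ∀ x ∈ T, F x = G x := by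
  classical
  constructor
  · rintro ⟨ψ, hψ⟩ F G hφ hC x hx
    have hr : C.restrict F = C.restrict G := funext fun y => hC y y.2
    have := (hψ F).symm.trans ((congrArg₂ ψ hφ hr).trans (hψ G))
    exact congrFun this ⟨x, hx⟩
  · intro h
    -- The decoder picks any contents consistent with its data; the default `0` is only returned on
    -- data that never occur.
    refine ⟨fun m c => if hF : ∃ F : Files N B, φ F = m ∧ C.restrict F = c then
      T.restrict hF.choose else 0, fun F => ?_⟩
    have hF : ∃ G : Files N B, φ G = φ F ∧ C.restrict G = C.restrict F := ⟨F, rfl, rfl⟩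
    simp only [dif_pos hF]
    ext x
    exact h _ _ hF.choose_spec.1 (fun y hy => congrFun hF.choose_spec.2 ⟨y, hy⟩) x x.2

theorem CanDecode.mono {N B q : ℕ} {φ : Files N B → Fin q} {C T T' : Finset (Fin N × Fin B)}
    (h : CanDecode φ C T) (hT : T' ⊆ C ∪ T) : CanDecode φ C T' := by
  rw [canDecode_iff] at h ⊢
  intro F G hφ hC x hx
  rcases mem_union.1 (hT hx) with hx | hx
  · exact hC x hx
  · exact h F G hφ hC x hx

/-- The owner of each file. -/
theorem IsAssignment.exists_owner {N K : ℕ} {d : Fin K → Finset (Fin N)} (hd : IsAssignment d) :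
    ∃ o : Fin N → Fin K, ∀ i f, f ∈ d i ↔ o f = i := by
  choose o ho hu using hd.2
  exact ⟨o, fun i f => ⟨fun h => (hu f i h).symm, fun h => h ▸ ho f⟩⟩

/-! ### Cache placement by labels and its update -/

section Labelling

variable {N K B : ℕ}

/-- The bits of each file are labelled by different sets of `s` workers, all of which contain the
worker to which the assignment `v` gives the file. -/
def IsLabelling (s : ℕ) (v : Fin K → Finset (Fin N)) (lab : Fin N → Fin B → Finset (Fin K)) :
    Prop :=
  (∀ f, Function.Injective (lab f)) ∧ (∀ f b, (lab f b).card = s) ∧ ∀ i, ∀ f ∈ v i, ∀ b, i ∈ lab f b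

/-- The cache of worker `i`: all bits whose label contains `i`. -/
def labelCache (lab : Fin N → Fin B → Finset (Fin K)) (i : Fin K) : Finset (Fin N × Fin B) :=
  univ.filter fun x => i ∈ lab x.1 x.2

theorem mem_labelCache {lab : Fin N → Fin B → Finset (Fin K)} {i : Fin K} {x : Fin N × Fin B} :
    x ∈ labelCache lab i ↔ i ∈ lab x.1 x.2 := by
  simp [labelCache]

theorem exists_isLabelling {s : ℕ} (hs : 1 ≤ s) {v : Fin K → Finset (Fin N)} (hv : IsAssignment v)
    (hB : B = (K - 1).choose (s - 1)) :
    ∃ lab : Fin N → Fin B → Finset (Fin K), IsLabelling s v lab := by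
  obtain ⟨o, ho⟩ := hv.exists_owner
  have key : ∀ f, ∃ l : Fin B → Finset (Fin K), Function.Injective l ∧
      ∀ b, (l b).card = s ∧ o f ∈ l b := by
    intro f
    have hc := card_filter_superset {o f} (s := s) (by simpa using hs)
    rw [Fintype.card_fin, card_singleton, ← hB] at hc
    refine ⟨fun b => ((Finset.equivFinOfCardEq hc).symm b).1, fun a b hab => ?_, fun b => ?_⟩
    · exact (Finset.equivFinOfCardEq hc).symm.injective (Subtype.ext hab)
    · have := ((Finset.equivFinOfCardEq hc).symm b).2
      simpa using this
  choose l hl hl' using key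
  refine ⟨l, hl, fun f b => (hl' f b).1, fun i f hf b => ?_⟩
  rw [← (ho i f).1 hf]
  exact (hl' f b).2

/-- Here `e` bounds the number of bits that a worker stores of a file it does not own: their labels
contain both the worker and the owner. The case `s = 1` is separate because `(K - 2).choose (s - 2)`
would then be `1` by truncated subtraction, while no label contains two workers. -/
theorem exists_pair_bound (K : ℕ) {s : ℕ} (hs : 1 ≤ s) :
    ∃ e : ℕ, (K - 1) * e ≤ (s - 1) * (K - 1).choose (s - 1) ∧
      ∀ i j : Fin K, i ≠ j →
        ((powersetCard s (univ : Finset (Fin K))).filter fun A => {i, j} ⊆ A).card ≤ e := by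
  rcases hs.eq_or_lt with rfl | hs
  · refine ⟨0, by simp, fun i j hij => ?_⟩
    rw [Nat.le_zero, card_eq_zero, filter_eq_empty_iff]
    intro A hA hsub
    have h1 := card_le_card hsub
    rw [card_pair hij, (mem_powersetCard.1 hA).2] at h1
    omega
  · obtain ⟨t, rfl⟩ : ∃ t, s = t + 2 := ⟨s - 2, by omega⟩
    refine ⟨(K - 2).choose t, ?_, fun i j hij => ?_⟩
    · rcases Nat.lt_or_ge K 2 with hK | hK
      · have : K - 1 = 0 := by omega
        simp [this]
      · obtain ⟨n, rfl⟩ : ∃ n, K = n + 2 := ⟨K - 2, by omega⟩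
        have := Nat.add_one_mul_choose_eq n t
        simp only [Nat.add_sub_cancel, Nat.add_succ_sub_one]
        rw [this, mul_comm]
    · have := card_filter_superset {i, j} (s := t + 2) (by rw [card_pair hij]; omega)
      rw [this, card_pair hij, Fintype.card_fin]
      rfl

/-- A worker stores its own `m` files in full and at most `e` bits of each of the other `(K - 1) *
m` files; the bound on `(K - 1) * e` turns this into `m * B + m * (s - 1) * B`. -/
theorem card_labelCache_le {m s : ℕ} (hN : N = K * m) (hs : 1 ≤ s) {v : Fin K → Finset (Fin N)}
    (hv : IsAssignment v) (hB : B = (K - 1).choose (s - 1))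
    {lab : Fin N → Fin B → Finset (Fin K)} (hlab : IsLabelling s v lab) (i : Fin K) :
    (labelCache lab i).card ≤ m * s * B := by
  obtain ⟨o, ho⟩ := hv.exists_owner
  obtain ⟨e, he, hpair⟩ := exists_pair_bound K hs
  have hKpos : 0 < K := i.pos
  have hm : (v i).card = m := by rw [hv.1 i, hN, Nat.mul_div_cancel_left m hKpos]
  have hsum : (labelCache lab i).card = ∑ f, (univ.filter fun b => i ∈ lab f b).card := by
    simp only [labelCache, card_filter, Fintype.sum_prod_type]
  have hle : ∀ f, (univ.filter fun b => i ∈ lab f b).card ≤ if f ∈ v i then B else e := by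
    intro f
    split_ifs with hf
    · exact (card_le_univ _).trans_eq (Fintype.card_fin B)
    · have hne : i ≠ o f := fun h => hf ((ho i f).2 h.symm)
      refine le_trans ?_ (hpair i (o f) hne)
      refine card_le_card_of_injOn (lab f) (fun b hb => ?_) (hlab.1 f).injOn
      have h1 : o f ∈ lab f b := hlab.2.2 _ f ((ho _ f).2 rfl) b
      have h2 : i ∈ lab f b := by simpa using hb
      simp [hlab.2.1 f b, insert_subset_iff, h1, h2]
  have hcompl : (univ.filter fun f => f ∉ v i).card = (K - 1) * m := by
    have h1 : (univ.filter fun f => f ∉ v i) = (v i)ᶜ := by ext; simp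
    rw [h1, card_compl, Fintype.card_fin, hm, hN, Nat.sub_mul, one_mul]
  calc (labelCache lab i).card ≤ ∑ f, (if f ∈ v i then B else e) :=
        hsum.trans_le (sum_le_sum fun f _ => hle f)
    _ = m * B + m * ((K - 1) * e) := by
        rw [sum_ite, sum_const, sum_const, hcompl, filter_mem_eq_inter, univ_inter, hm]
        simp only [smul_eq_mul]
        ring
    _ ≤ m * B + m * ((s - 1) * B) := by
        rw [← hB] at he
        gcongr
    _ = m * s * B := by
        obtain ⟨t, rfl⟩ : ∃ t, s = t + 1 := ⟨s - 1, by omega⟩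
        rw [Nat.add_sub_cancel]
        ring

theorem isPlacement_labelCache {m s : ℕ} (hN : N = K * m) (hs : 1 ≤ s)
    {v : Fin K → Finset (Fin N)} (hv : IsAssignment v) (hB : B = (K - 1).choose (s - 1))
    {lab : Fin N → Fin B → Finset (Fin K)} (hlab : IsLabelling s v lab) :
    IsPlacement (m * s) v (labelCache lab) := by
  refine fun i => ⟨fun x hx => ?_, card_labelCache_le hN hs hv hB hlab i⟩
  exact mem_labelCache.2 (hlab.2.2 i x.1 (mem_product.1 hx).1 x.2)

/-- The labels after the transition from `v` to `d`: if a file moves from worker `i` to worker `l`,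
then `i` and `l` exchange their roles in the labels of its bits. -/
theorem IsLabelling.exists_next {s : ℕ} {v d : Fin K → Finset (Fin N)} (hv : IsAssignment v)
    (hd : IsAssignment d) {lab : Fin N → Fin B → Finset (Fin K)} (hlab : IsLabelling s v lab) :
    ∃ lab' : Fin N → Fin B → Finset (Fin K), IsLabelling s d lab' ∧
      ∀ i, labelCache lab' i ⊆ labelCache lab i ∪ allBits B (d i) := by
  obtain ⟨o, ho⟩ := hv.exists_owner
  obtain ⟨p, hp⟩ := hd.exists_owner
  have hmem : ∀ f b i, i ∈ (lab f b).map (Equiv.swap (o f) (p f)).toEmbedding ↔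
      Equiv.swap (o f) (p f) i ∈ lab f b := by
    intro f b i
    rw [mem_map_equiv, Equiv.symm_swap]
  have ho' : ∀ f b, o f ∈ lab f b := fun f b => hlab.2.2 _ f ((ho _ f).2 rfl) b
  refine ⟨fun f b => (lab f b).map (Equiv.swap (o f) (p f)).toEmbedding, ⟨?_, ?_, ?_⟩, ?_⟩
  · exact fun f => (map_injective _).comp (hlab.1 f)
  · exact fun f b => (card_map _).trans (hlab.2.1 f b)
  · intro i f hf b
    rw [hmem, ← (hp i f).1 hf, Equiv.swap_apply_right]
    exact ho' f b
  · rintro i ⟨f, b⟩ hx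
    rw [mem_labelCache, hmem] at hx
    rw [mem_union, mem_labelCache]
    by_cases hpi : p f = i
    · exact Or.inr (mem_product.2 ⟨(hp i f).2 hpi, mem_univ _⟩)
    · left
      by_cases hoi : o f = i
      · exact hoi ▸ ho' f b
      · rwa [Equiv.swap_apply_of_ne_of_ne (Ne.symm hoi) (Ne.symm hpi)] at hx

end Labelling

/-! ### Broadcasting cycles and decoding -/

section Delivery

variable {N K B : ℕ}

/-- The bits of file `f`, as a chain on the simplex of all workers. -/
def fileChain (lab : Fin N → Fin B → Finset (Fin K)) (F : Files N B) (f : Fin N)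
    (A : Finset (Fin K)) : ZMod 2 :=
  ∑ b, if lab f b = A then F (f, b) else 0

theorem fileChain_sub (lab : Fin N → Fin B → Finset (Fin K)) (F G : Files N B) (f : Fin N) :
    fileChain lab (F - G) f = fileChain lab F f - fileChain lab G f := by
  ext A
  simp only [fileChain, Pi.sub_apply, ← sum_sub_distrib]
  exact sum_congr rfl fun b _ => by split_ifs <;> simp

theorem fileChain_label {lab : Fin N → Fin B → Finset (Fin K)} {f : Fin N}
    (h : Function.Injective (lab f)) (F : Files N B) (b : Fin B) :
    fileChain lab F f (lab f b) = F (f, b) := by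
  simp [fileChain, h.eq_iff]

theorem fileChain_eq_zero {lab : Fin N → Fin B → Finset (Fin K)} {F : Files N B} {f : Fin N}
    {A : Finset (Fin K)} (h : ∀ b, lab f b = A → F (f, b) = 0) : fileChain lab F f A = 0 :=
  sum_eq_zero fun b _ => by
    split_ifs with hb
    exacts [h b hb, rfl]

/-- The chain whose coefficients are broadcast for the files of one colour, if `p` is the next
assignment. -/
def broadcastChain {m : ℕ} (lab : Fin N → Fin B → Finset (Fin K)) (p : Fin N → Fin K)
    (col : Fin N → Fin m) (F : Files N B) (c : Fin m) : Finset (Fin K) → ZMod 2 :=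
  ∑ f with col f = c, boundary (cone (p f) (fileChain lab F f))

theorem broadcastChain_sub {m : ℕ} (lab : Fin N → Fin B → Finset (Fin K)) (p : Fin N → Fin K)
    (col : Fin N → Fin m) (F G : Files N B) (c : Fin m) :
    broadcastChain lab p col (F - G) c =
      broadcastChain lab p col F c - broadcastChain lab p col G c := by
  simp only [broadcastChain, fileChain_sub, cone_sub, boundary_sub, sum_sub_distrib]

theorem boundary_broadcastChain {m : ℕ} (lab : Fin N → Fin B → Finset (Fin K)) (p : Fin N → Fin K)
    (col : Fin N → Fin m) (F : Files N B) (c : Fin m) :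
    boundary (broadcastChain lab p col F c) = 0 := by
  simp only [broadcastChain, boundary_sum, boundary_boundary, sum_const_zero]

/-- A worker decodes its new files: if its cached bits and all broadcast chains vanish, then so do
the bits of its new files. -/
theorem eq_zero_of_broadcastChain_eq_zero {m s : ℕ} {v : Fin K → Finset (Fin N)}
    (hv : IsAssignment v) {lab : Fin N → Fin B → Finset (Fin K)} (hlab : IsLabelling s v lab)
    {p : Fin N → Fin K} {col : Fin N → Fin m}
    (hcol : ∀ f g, p f = p g → col f = col g → f = g) {F : Files N B}
    (hX : ∀ c D, D.card = s → broadcastChain lab p col F c D = 0) {i : Fin K}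
    (hF : ∀ x ∈ labelCache lab i, F x = 0) (f : Fin N) (hf : p f = i) (b : Fin B) :
    F (f, b) = 0 := by
  obtain ⟨o, ho⟩ := hv.exists_owner
  have hknown : ∀ g A, i ∈ A → fileChain lab F g A = 0 := fun g A hA =>
    fileChain_eq_zero fun b hb => hF _ (mem_labelCache.2 (hb ▸ hA))
  by_cases hib : i ∈ lab f b
  · exact hF _ (mem_labelCache.2 hib)
  have hob : o f ∈ lab f b := hlab.2.2 _ f ((ho _ f).2 rfl) b
  have hoi : o f ≠ i := fun h => hib (h ▸ hob)
  -- The broadcast is read at the label of the missing bit with the old owner exchanged for `i`.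
  -- This simplex contains `i`, so every file chain vanishes there, and the homotopy identity
  -- replaces the boundary of each cone by the cone of the boundary.
  have hcard : (insert i ((lab f b).erase (o f))).card = s := by
    rw [card_insert_of_notMem (by simp [hib]), card_erase_add_one hob, hlab.2.1]
  have hterm : ∀ g, boundary (cone (p g) (fileChain lab F g)) (insert i ((lab f b).erase (o f))) =
      cone (p g) (boundary (fileChain lab F g)) (insert i ((lab f b).erase (o f))) := by
    intro g
    have h := boundary_cone_add_cone_boundary (p g) (fileChain lab F g)
      (insert i ((lab f b).erase (o f)))
    rw [hknown g _ (mem_insert_self _ _)] at h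
    exact CharTwo.add_eq_zero.1 h
  have h1 := hX (col f) _ hcard
  rw [broadcastChain, Finset.sum_apply, Finset.sum_eq_single_of_mem f (by simp), hterm, cone, hf,
    if_pos (mem_insert_self _ _), erase_insert (by simp [hib]), boundary,
    Finset.sum_eq_single_of_mem (o f) (by simp), insert_erase hob,
    fileChain_label (hlab.1 f)] at h1
  · exact h1
  -- All labels of `f` contain `o f`, so the boundary has only one surviving term: the wanted bit.
  · intro j _ hj
    refine fileChain_eq_zero fun b' hb' => ?_
    have : o f ∈ lab f b' := hlab.2.2 _ f ((ho _ f).2 rfl) b'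
    rw [hb'] at this
    simp [hj.symm] at this
  -- Another file of the same colour goes to a worker other than `i`. Removing its apex leaves `i`
  -- in the simplex, so worker `i` has cached all terms of the boundary.
  · intro g hg hgf
    have hpg : p g ≠ i := fun h => hgf (hcol g f (h.trans hf.symm) (mem_filter.1 hg).2)
    rw [hterm, cone]
    split_ifs
    · refine sum_eq_zero fun j _ => hknown g _ ?_
      exact mem_insert_of_mem (mem_erase.2 ⟨hpg.symm, mem_insert_self _ _⟩)
    · rfl

theorem exists_colouring {m : ℕ} {d : Fin K → Finset (Fin N)} (hm : ∀ i, (d i).card = m)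
    {p : Fin N → Fin K} (hp : ∀ i f, f ∈ d i ↔ p f = i) :
    ∃ col : Fin N → Fin m, ∀ f g, p f = p g → col f = col g → f = g := by
  refine ⟨fun f => (Finset.equivFinOfCardEq (hm (p f))) ⟨f, (hp _ f).2 rfl⟩, fun f g hfg h => ?_⟩
  -- The numberings of `d (p f)` and `d (p g)` have different domain types; both are moved to a
  -- common index before injectivity is used.
  have key : ∀ i (hi : p f = i) (hj : p g = i),
      (Finset.equivFinOfCardEq (hm (p f))) ⟨f, (hp _ f).2 rfl⟩ =
        (Finset.equivFinOfCardEq (hm i)) ⟨f, (hp _ f).2 hi⟩ ∧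
      (Finset.equivFinOfCardEq (hm (p g))) ⟨g, (hp _ g).2 rfl⟩ =
        (Finset.equivFinOfCardEq (hm i)) ⟨g, (hp _ g).2 hj⟩ := by
    intro i hi hj
    constructor
    · subst hi; rfl
    · subst hj; rfl
  obtain ⟨h1, h2⟩ := key (p g) hfg rfl
  simp only [h1] at h
  exact congrArg Subtype.val ((Finset.equivFinOfCardEq (hm (p g))).injective h)

/-- The message lists, for each colour, only the coefficients on simplices avoiding `k`; the others
follow because the chain is a cycle. As the broadcast is additive in the files, decodability reduces
to the difference of two file contents with the same message and cache. -/
theorem exists_delivers_labelCache {m s : ℕ} {v d : Fin K → Finset (Fin N)} (hv : IsAssignment v)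
    (hd : IsAssignment d) (hm : ∀ i, (d i).card = m) (k : Fin K)
    {lab : Fin N → Fin B → Finset (Fin K)} (hlab : IsLabelling s v lab) :
    ∃ φ : Files N B → Fin (2 ^ (m * (K - 1).choose s)), Delivers φ (labelCache lab) d := by
  obtain ⟨p, hp⟩ := hd.exists_owner
  obtain ⟨col, hcol⟩ := exists_colouring hm hp
  have hcard : Fintype.card (Fin m × powersetCard s (univ.erase k) → ZMod 2) =
      2 ^ (m * (K - 1).choose s) := by
    rw [Fintype.card_fun, ZMod.card, Fintype.card_prod, Fintype.card_fin, Fintype.card_coe,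
      card_powersetCard, card_erase_of_mem (mem_univ k), card_univ, Fintype.card_fin]
  refine ⟨fun F => Fintype.equivFinOfCardEq hcard fun x => broadcastChain lab p col F x.1 x.2.1,
    fun i => canDecode_iff.2 fun F G hφ hC x hx => ?_⟩
  have hφ' := (Fintype.equivFinOfCardEq hcard).injective hφ
  have hX : ∀ c D, D.card = s → broadcastChain lab p col (F - G) c D = 0 := by
    intro c
    refine eq_zero_of_boundary_eq_zero (boundary_broadcastChain lab p col _ c) k fun D hD hk => ?_
    have hmem : D ∈ powersetCard s (univ.erase k) :=
      mem_powersetCard.2 ⟨fun x hx => mem_erase.2 ⟨fun h => hk (h ▸ hx), mem_univ x⟩, hD⟩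
    rw [broadcastChain_sub, Pi.sub_apply, sub_eq_zero]
    exact congrFun hφ' (c, ⟨D, hmem⟩)
  have := eq_zero_of_broadcastChain_eq_zero hv hlab hcol hX
    (fun y hy => sub_eq_zero.2 (hC y hy)) x.1 ((hp i x.1).1 (mem_product.1 hx).1) x.2
  exact sub_eq_zero.1 this

end Delivery

/-! ### The scheme over infinitely many iterations -/

theorem perpetuallyAchievable {N K m s : ℕ} (hK : 0 < K) (hN : N = K * m) (hs : 1 ≤ s)
    (hsK : s ≤ K) {u : Fin K → Finset (Fin N)} (hu : IsAssignment u) :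
    PerpetuallyAchievable (m * s) u
      ((m : ℝ) * ((K - 1).choose s : ℝ) / ((K - 1).choose (s - 1) : ℝ)) := by
  -- The invariant is that the caches come from some labelling for the current assignment; each file
  -- has one bit per `s`-set containing its owner.
  refine ⟨(K - 1).choose (s - 1), Nat.choose_pos (by omega),
    {x | IsAssignment x.1 ∧ ∃ lab, IsLabelling s x.1 lab ∧ x.2 = labelCache lab}, ?_, ?_⟩
  · obtain ⟨lab, hlab⟩ := exists_isLabelling hs hu rfl
    exact ⟨labelCache lab, hu, lab, hlab, rfl⟩
  · rintro v Z ⟨hv, lab, hlab, rfl⟩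
    refine ⟨isPlacement_labelCache hN hs hv rfl hlab, fun d hd => ?_⟩
    have hm : ∀ i, (d i).card = m := fun i => by rw [hd.1 i, hN, Nat.mul_div_cancel_left m hK]
    obtain ⟨φ, hφ⟩ := exists_delivers_labelCache hv hd hm ⟨0, hK⟩ hlab
    obtain ⟨lab', hlab', hsub⟩ := hlab.exists_next hv hd
    refine ⟨_, φ, hφ, ?_, labelCache lab', ⟨hd, lab', hlab', rfl⟩, fun i => (hφ i).mono (hsub i)⟩
    rw [load]
    push_cast
    rw [Real.logb_pow, Real.logb_self_eq_one one_lt_two, mul_one]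
    push_cast
    exact le_rfl

/-! ### Counting orders by their first element -/

section Orders

variable {K : ℕ}

/-- The orders `τ` of all workers in which `o` precedes all other elements of `A`. -/
def ordersWithFirst (A : Finset (Fin K)) (o : Fin K) : Finset (Equiv.Perm (Fin K)) :=
  univ.filter fun τ => ∀ a ∈ A, τ.symm o ≤ τ.symm a

theorem mem_ordersWithFirst {A : Finset (Fin K)} {o : Fin K} {τ : Equiv.Perm (Fin K)} :
    τ ∈ ordersWithFirst A o ↔ ∀ a ∈ A, τ.symm o ≤ τ.symm a := by
  simp [ordersWithFirst]

theorem ordersWithFirst_anti {A A' : Finset (Fin K)} (h : A ⊆ A') (o : Fin K) :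
    ordersWithFirst A' o ⊆ ordersWithFirst A o := fun _ hτ =>
  mem_ordersWithFirst.2 fun a ha => mem_ordersWithFirst.1 hτ a (h ha)

theorem card_ordersWithFirst_le {A : Finset (Fin K)} {o o' : Fin K} (ho : o ∈ A) (ho' : o' ∈ A) :
    (ordersWithFirst A o).card ≤ (ordersWithFirst A o').card := by
  refine card_le_card_of_injOn (fun τ => Equiv.swap o o' * τ) (fun τ hτ => ?_)
    (mul_right_injective _).injOn
  rw [mem_coe, mem_ordersWithFirst] at hτ ⊢
  intro a ha
  have hsymm : ∀ b, (Equiv.swap o o' * τ).symm b = τ.symm (Equiv.swap o o' b) := fun b => by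
    rw [Equiv.symm_apply_eq, Equiv.Perm.mul_apply, Equiv.apply_symm_apply, Equiv.swap_apply_self]
  rw [hsymm, hsymm, Equiv.swap_apply_right]
  refine hτ _ ?_
  rw [Equiv.swap_apply_def]
  split_ifs <;> assumption

/-- Every order has exactly one first element of `A`, and by symmetry under transpositions each
element of `A` comes first equally often. -/
theorem card_mul_card_ordersWithFirst {A : Finset (Fin K)} {o : Fin K} (ho : o ∈ A) :
    A.card * (ordersWithFirst A o).card = K.factorial := by
  have hdisj : (A : Set (Fin K)).PairwiseDisjoint (ordersWithFirst A) := by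
    intro a ha b hb hab
    refine disjoint_left.2 fun τ h1 h2 => hab (τ.symm.injective ?_)
    exact le_antisymm (mem_ordersWithFirst.1 h1 b hb) (mem_ordersWithFirst.1 h2 a ha)
  have huniv : A.biUnion (ordersWithFirst A) = univ := by
    refine eq_univ_of_forall fun τ => ?_
    obtain ⟨a, ha, hmin⟩ := exists_min_image A τ.symm ⟨o, ho⟩
    exact mem_biUnion.2 ⟨a, ha, mem_ordersWithFirst.2 hmin⟩
  have hcard := card_biUnion hdisj
  rw [huniv, card_univ, Fintype.card_perm, Fintype.card_fin] at hcard
  rw [hcard, ← smul_eq_mul, ← sum_const]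
  exact sum_congr rfl fun a ha =>
    (card_ordersWithFirst_le ho ha).antisymm (card_ordersWithFirst_le ha ho)

end Orders

/-! ### Lower bound by averaging over cyclic shuffles -/

section Converse

variable {N K B : ℕ}

/-- The shuffle along the cycle that visits the workers in the order `τ`. -/
def cycleAlong (u : Fin K → Finset (Fin N)) (τ : Equiv.Perm (Fin K)) : Fin K → Finset (Fin N) :=
  fun i => u (τ (finRotate K (τ.symm i)))

/-- The workers that store a bit. -/
def holders (Z : Fin K → Finset (Fin N × Fin B)) (x : Fin N × Fin B) : Finset (Fin K) :=
  univ.filter fun i => x ∈ Z i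

theorem mem_holders {Z : Fin K → Finset (Fin N × Fin B)} {x : Fin N × Fin B} {i : Fin K} :
    i ∈ holders Z x ↔ x ∈ Z i := by
  simp [holders]

theorem sum_card_holders (Z : Fin K → Finset (Fin N × Fin B)) :
    ∑ x, (holders Z x).card = ∑ i, (Z i).card := by
  simp only [holders, card_filter]
  rw [sum_comm]
  simp

/-- The bits whose owner is the first in the order `τ` among the workers that store the bit, but
not the first of all workers. -/
def neededBits (o : Fin N → Fin K) (Z : Fin K → Finset (Fin N × Fin B))
    (τ : Equiv.Perm (Fin K)) : Finset (Fin N × Fin B) :=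
  univ.filter fun x => τ ∈ ordersWithFirst (holders Z x) (o x.1) \ ordersWithFirst univ (o x.1)

/-- With all other bits fixed, the message determines the needed bits, so it is injective in them.
-/
theorem two_pow_card_neededBits_le {q : ℕ} {u : Fin K → Finset (Fin N)} {o : Fin N → Fin K}
    (ho : ∀ i f, f ∈ u i ↔ o f = i) {Z : Fin K → Finset (Fin N × Fin B)}
    {τ : Equiv.Perm (Fin K)} {φ : Files N B → Fin q} (hφ : Delivers φ Z (cycleAlong u τ)) :
    2 ^ (neededBits o Z τ).card ≤ q := by
  classical
  -- Induction along the cycle. Bits owned by the first worker are never needed. The worker at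
  -- position `n` receives the block of position `n + 1`; a bit in its cache either has its owner at
  -- a position at most `n`, or is not needed because this worker holds it and precedes the owner.
  have key : ∀ F G : Files N B, φ F = φ G → (∀ x ∉ neededBits o Z τ, F x = G x) →
      ∀ n : ℕ, ∀ x, (τ.symm (o x.1)).val ≤ n → F x = G x := by
    intro F G hFG hT n
    induction n with
    | zero =>
      intro x hx
      refine hT x fun hmem => ?_
      simp only [neededBits, mem_filter, mem_sdiff] at hmem
      exact hmem.2.2 (mem_ordersWithFirst.2 fun a _ => Fin.le_def.2 (hx.trans (Nat.zero_le _)))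
    | succ n ih =>
      intro x hx
      rcases Nat.lt_or_ge n (τ.symm (o x.1)).val with hlt | hle
      swap
      · exact ih x hle
      have heq : (τ.symm (o x.1)).val = n + 1 := le_antisymm hx hlt
      have hn : n + 1 < K := heq ▸ (τ.symm (o x.1)).isLt
      have hrot : finRotate K ⟨n, by omega⟩ = τ.symm (o x.1) := by
        obtain ⟨k, rfl⟩ : ∃ k, K = k + 1 := ⟨K - 1, by omega⟩
        rw [finRotate_of_lt (by omega)]
        exact Fin.ext heq.symm
      have hdec := canDecode_iff.1 (hφ (τ ⟨n, by omega⟩)) F G hFG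
      refine hdec (fun y hy => ?_) x ?_
      · rcases Nat.lt_or_ge n (τ.symm (o y.1)).val with hlt' | hle'
        swap
        · exact ih y hle'
        refine hT y fun hmem => ?_
        simp only [neededBits, mem_filter, mem_sdiff] at hmem
        have h := mem_ordersWithFirst.1 hmem.2.1 _ (mem_holders.2 hy)
        rw [Equiv.symm_apply_apply, Fin.le_def] at h
        exact absurd h (not_le.2 hlt')
      · refine mem_product.2 ⟨?_, mem_univ _⟩
        rw [cycleAlong, Equiv.symm_apply_apply, hrot, Equiv.apply_symm_apply]
        exact (ho _ _).2 rfl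
  have hinj : Function.Injective fun c : neededBits o Z τ → ZMod 2 =>
      φ fun x => if h : x ∈ neededBits o Z τ then c ⟨x, h⟩ else 0 := by
    intro c e hce
    ext ⟨x, hx⟩
    have h := key _ _ hce (fun y hy => by simp only [dif_neg hy]) _ x le_rfl
    simp only [dif_pos hx] at h
    rw [h]
  have := Fintype.card_le_of_injective _ hinj
  rwa [Fintype.card_fun, ZMod.card, Fintype.card_coe, Fintype.card_fin] at this

theorem card_neededBits_le_load {q : ℕ} {u : Fin K → Finset (Fin N)} {o : Fin N → Fin K}
    (ho : ∀ i f, f ∈ u i ↔ o f = i) {Z : Fin K → Finset (Fin N × Fin B)}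
    {τ : Equiv.Perm (Fin K)} {φ : Files N B → Fin q} (hφ : Delivers φ Z (cycleAlong u τ)) :
    ((neededBits o Z τ).card : ℝ) / B ≤ load q B := by
  have h : (2 : ℝ) ^ (neededBits o Z τ).card ≤ q := by
    exact_mod_cast two_pow_card_neededBits_le ho hφ
  refine div_le_div_of_nonneg_right ?_ (Nat.cast_nonneg B)
  have h2 := Real.logb_le_logb_of_le one_lt_two (by positivity) h
  rwa [Real.logb_pow, Real.logb_self_eq_one one_lt_two, mul_one] at h2

/-- For each bit, the orders with the owner first among all workers are a subset of those with the
owner first among the holders, so the two counts subtract. -/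
theorem sum_card_neededBits {o : Fin N → Fin K} {Z : Fin K → Finset (Fin N × Fin B)}
    (hoZ : ∀ x, x ∈ Z (o x.1)) :
    ∑ τ, ((neededBits o Z τ).card : ℝ) =
      (K.factorial : ℝ) * ∑ x, (1 / ((holders Z x).card : ℝ) - 1 / (K : ℝ)) := by
  have hswap : ∑ τ, (neededBits o Z τ).card =
      ∑ x : Fin N × Fin B,
        (ordersWithFirst (holders Z x) (o x.1) \ ordersWithFirst univ (o x.1)).card := by
    simp only [neededBits, card_filter]
    rw [sum_comm]
    exact sum_congr rfl fun x _ => by rw [← card_filter, filter_univ_mem]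
  rw [← Nat.cast_sum, hswap, Nat.cast_sum, mul_sum]
  refine sum_congr rfl fun x _ => ?_
  have hmem : o x.1 ∈ holders Z x := mem_holders.2 (hoZ x)
  rw [card_sdiff_of_subset (ordersWithFirst_anti (subset_univ _) _),
    Nat.cast_sub (card_le_card (ordersWithFirst_anti (subset_univ _) _)), mul_sub]
  have hpos : (0 : ℝ) < (holders Z x).card := by exact_mod_cast card_pos.2 ⟨_, hmem⟩
  have hKpos : (0 : ℝ) < K := by exact_mod_cast (o x.1).pos
  have h1 : ((holders Z x).card : ℝ) * (ordersWithFirst (holders Z x) (o x.1)).card =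
      K.factorial := by
    exact_mod_cast card_mul_card_ordersWithFirst hmem
  have h2 : (K : ℝ) * (ordersWithFirst univ (o x.1)).card = K.factorial := by
    have := card_mul_card_ordersWithFirst (mem_univ (o x.1))
    rw [card_univ, Fintype.card_fin] at this
    exact_mod_cast this
  congr 1
  · rw [← h1]
    field_simp
  · rw [← h2]
    field_simp

theorem sum_one_div_card_holders_ge {s : ℕ} (hs : 1 ≤ s) {o : Fin N → Fin K}
    {Z : Fin K → Finset (Fin N × Fin B)} (hoZ : ∀ x, x ∈ Z (o x.1))
    (hZ : ∑ i, (Z i).card ≤ N * s * B) :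
    (N : ℝ) * B / s ≤ ∑ x, 1 / ((holders Z x).card : ℝ) := by
  have hs0 : (0 : ℝ) < s := by exact_mod_cast hs
  -- The convex function `1 / t` lies above its tangent at `t = s`, the average number of holders
  -- allowed by the cache budget.
  have htangent : ∀ x, 2 / (s : ℝ) - (holders Z x).card / (s : ℝ) ^ 2 ≤
      1 / ((holders Z x).card : ℝ) := by
    intro x
    have ht : (0 : ℝ) < (holders Z x).card := by
      exact_mod_cast card_pos.2 ⟨_, mem_holders.2 (hoZ x)⟩
    have : 1 / ((holders Z x).card : ℝ) - (2 / (s : ℝ) - (holders Z x).card / (s : ℝ) ^ 2) =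
        ((s : ℝ) - (holders Z x).card) ^ 2 / ((holders Z x).card * (s : ℝ) ^ 2) := by
      field_simp
      ring
    have h0 : 0 ≤ ((s : ℝ) - (holders Z x).card) ^ 2 / ((holders Z x).card * (s : ℝ) ^ 2) := by
      positivity
    linarith
  have hsum : (∑ x, ((holders Z x).card : ℝ)) ≤ N * s * B := by
    exact_mod_cast (sum_card_holders Z).trans_le hZ
  calc (N : ℝ) * B / s = (N * B) * (2 / s) - N * s * B / (s : ℝ) ^ 2 := by
        field_simp
        ring
    _ ≤ (N * B) * (2 / s) - (∑ x, ((holders Z x).card : ℝ)) / (s : ℝ) ^ 2 := by gcongr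
    _ = ∑ x, (2 / (s : ℝ) - (holders Z x).card / (s : ℝ) ^ 2) := by
        rw [sum_sub_distrib, sum_div]
        simp
    _ ≤ _ := sum_le_sum fun x _ => htangent x

theorem le_sum_card_neededBits {m s : ℕ} (hK : 0 < K) (hN : N = K * m) (hs : 1 ≤ s)
    {u : Fin K → Finset (Fin N)} {o : Fin N → Fin K} (ho : ∀ i f, f ∈ u i ↔ o f = i)
    {Z : Fin K → Finset (Fin N × Fin B)} (hZ : IsPlacement (m * s) u Z) :
    (K.factorial : ℝ) * (m * B * ((K : ℝ) - s) / s) ≤ ∑ τ, ((neededBits o Z τ).card : ℝ) := by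
  have hoZ : ∀ x, x ∈ Z (o x.1) := fun x =>
    (hZ _).1 (mem_product.2 ⟨(ho _ _).2 rfl, mem_univ _⟩)
  have hcard : ∑ i, (Z i).card ≤ N * s * B := by
    refine (sum_le_sum fun i _ => (hZ i).2).trans_eq ?_
    rw [sum_const, card_univ, Fintype.card_fin, smul_eq_mul, hN]
    ring
  have h := sum_one_div_card_holders_ge hs hoZ hcard
  rw [sum_card_neededBits hoZ]
  refine mul_le_mul_of_nonneg_left ?_ (Nat.cast_nonneg _)
  have hK0 : (0 : ℝ) < K := by exact_mod_cast hK
  have hs0 : (0 : ℝ) < s := by exact_mod_cast hs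
  calc (m : ℝ) * B * ((K : ℝ) - s) / s = N * B / s - N * B * (1 / K) := by
        rw [hN]
        push_cast
        field_simp
    _ ≤ _ := by
        rw [sum_sub_distrib]
        simpa using h

theorem card_inter_eq {u : Fin K → Finset (Fin N)} {o : Fin N → Fin K}
    (ho : ∀ i f, f ∈ u i ↔ o f = i) {m : ℕ} (hm : ∀ i, (u i).card = m) (i l : Fin K) :
    (u i ∩ u l).card = if i = l then m else 0 := by
  split_ifs with h
  · rw [h, inter_self, hm]
  · rw [card_eq_zero, ← disjoint_iff_inter_eq_empty, disjoint_left]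
    exact fun f h1 h2 => h (((ho _ _).1 h1).symm.trans ((ho _ _).1 h2))

theorem isAssignment_cycleAlong {u : Fin K → Finset (Fin N)} (hu : IsAssignment u)
    (τ : Equiv.Perm (Fin K)) : IsAssignment (cycleAlong u τ) := by
  obtain ⟨o, ho⟩ := hu.exists_owner
  refine ⟨fun i => hu.1 _, fun f => ⟨τ ((finRotate K).symm (τ.symm (o f))), ?_, fun i hi => ?_⟩⟩
  · simp only [cycleAlong, Equiv.symm_apply_apply, Equiv.apply_symm_apply]
    exact (ho _ _).2 rfl
  · simp only [(ho _ _).1 hi, Equiv.symm_apply_apply, Equiv.apply_symm_apply]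

/-- In such a graph all `m` edges into a vertex come from a single vertex, so each new block is an
entire old block; the order `τ` is the inverse of the graph isomorphism. -/
theorem graphClass_cyclicShuffle {m : ℕ} {u : Fin K → Finset (Fin N)}
    (hu : IsAssignment u) (hm : ∀ i, (u i).card = m) :
    (graphClass u (cyclicShuffle u) : Set (Fin K → Finset (Fin N))) =
      Set.range (cycleAlong u) := by
  obtain ⟨o, ho⟩ := hu.exists_owner
  ext d
  simp only [graphClass, coe_filter, mem_univ, true_and, Set.mem_ofPred_eq, Set.mem_range]
  constructor
  · rintro ⟨hd, σ, hσ⟩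
    refine ⟨σ.symm, funext fun l => ?_⟩
    have h := hσ (σ.symm (finRotate K (σ l))) l
    rw [cyclicShuffle, Equiv.apply_symm_apply, card_inter_eq ho hm, if_pos rfl] at h
    have hsub : u (σ.symm (finRotate K (σ l))) ∩ d l = u (σ.symm (finRotate K (σ l))) :=
      eq_of_subset_of_card_le inter_subset_left (by rw [h, hm])
    have hcard : (d l).card = m := (hd.1 l).trans ((hu.1 l).symm.trans (hm l))
    exact eq_of_subset_of_card_le (inter_eq_left.1 hsub) (hcard.trans (hm _).symm).le
  · rintro ⟨τ, rfl⟩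
    refine ⟨isAssignment_cycleAlong hu τ, τ.symm, fun i l => ?_⟩
    rw [cycleAlong, cyclicShuffle, card_inter_eq ho hm, card_inter_eq ho hm]
    simp [Equiv.symm_apply_eq]

/-- For injective `u`, the shuffle depends exactly on the conjugate of the rotation by `τ`; the
fibres are the left cosets of the centralizer of the rotation. -/
theorem card_fiber_cycleAlong {u : Fin K → Finset (Fin N)} (hu : Function.Injective u)
    (τ₀ : Equiv.Perm (Fin K)) :
    (univ.filter fun τ => cycleAlong u τ = cycleAlong u τ₀).card =
      (univ.filter fun τ => cycleAlong u τ = cycleAlong u 1).card := by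
  have hiff : ∀ τ ρ : Equiv.Perm (Fin K), cycleAlong u τ = cycleAlong u ρ ↔
      τ * finRotate K * τ⁻¹ = ρ * finRotate K * ρ⁻¹ := fun τ ρ =>
    ⟨fun h => Equiv.ext fun i => hu (congrFun h i),
      fun h => funext fun i => congrArg u (Equiv.congr_fun h i)⟩
  simp only [hiff]
  refine card_nbij' (fun τ => τ₀⁻¹ * τ) (fun τ => τ₀ * τ) ?_ ?_ ?_ ?_
  · intro τ hτ
    simp only [mem_coe, mem_filter, mem_univ, true_and] at hτ ⊢
    calc τ₀⁻¹ * τ * finRotate K * (τ₀⁻¹ * τ)⁻¹ = τ₀⁻¹ * (τ * finRotate K * τ⁻¹) * τ₀ := by group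
      _ = 1 * finRotate K * 1⁻¹ := by rw [hτ]; group
  · intro τ hτ
    simp only [mem_coe, mem_filter, mem_univ, true_and] at hτ ⊢
    calc τ₀ * τ * finRotate K * (τ₀ * τ)⁻¹ = τ₀ * (τ * finRotate K * τ⁻¹) * τ₀⁻¹ := by group
      _ = τ₀ * finRotate K * τ₀⁻¹ := by rw [hτ]; group
  · intro τ _
    simp
  · intro τ _
    simp

theorem sum_graphClass_div_card {m : ℕ} (hm0 : 0 < m) {u : Fin K → Finset (Fin N)}
    (hu : IsAssignment u) (hm : ∀ i, (u i).card = m) (r : (Fin K → Finset (Fin N)) → ℝ) :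
    (∑ d ∈ graphClass u (cyclicShuffle u), r d) / ((graphClass u (cyclicShuffle u)).card : ℝ) =
      (∑ τ, r (cycleAlong u τ)) / (K.factorial : ℝ) := by
  classical
  obtain ⟨o, ho⟩ := hu.exists_owner
  have hinj : Function.Injective u := by
    intro i l h
    obtain ⟨f, hf⟩ := card_pos.1 ((hm i).symm ▸ hm0)
    exact ((ho _ _).1 hf).symm.trans ((ho _ _).1 (h ▸ hf))
  have himage : graphClass u (cyclicShuffle u) = univ.image (cycleAlong u) := by
    rw [← coe_inj, graphClass_cyclicShuffle hu hm, coe_image, coe_univ, Set.image_univ]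
  set c := (univ.filter fun τ => cycleAlong u τ = cycleAlong u 1).card with hc
  have hcpos : 0 < c := card_pos.2 ⟨1, by simp⟩
  have hsum : ∀ g : (Fin K → Finset (Fin N)) → ℝ,
      ∑ τ, g (cycleAlong u τ) = c * ∑ d ∈ graphClass u (cyclicShuffle u), g d := by
    intro g
    rw [sum_comp g (cycleAlong u), himage, mul_sum]
    refine sum_congr rfl fun d hd => ?_
    obtain ⟨τ₀, -, rfl⟩ := mem_image.1 hd
    rw [card_fiber_cycleAlong hinj, nsmul_eq_mul]
  -- The constant function gives `K.factorial` as fibre size times size of the class, so the fibre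
  -- size cancels from the average.
  have hcard := hsum fun _ => 1
  simp only [sum_const, card_univ, Fintype.card_perm, Fintype.card_fin, nsmul_eq_mul,
    mul_one] at hcard
  rw [hsum, hcard, mul_div_mul_left _ _ (by exact_mod_cast hcpos.ne')]

theorem AverageAchievable.le {m s : ℕ} (hK : 0 < K) (hm0 : 0 < m) (hN : N = K * m) (hs : 1 ≤ s)
    {u : Fin K → Finset (Fin N)} (hu : IsAssignment u) {R : ℝ}
    (h : AverageAchievable (m * s) u (cyclicShuffle u) R) : (m : ℝ) * ((K : ℝ) - s) / s ≤ R := by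
  obtain ⟨B, hB, Z, hZ, r, hr, hR⟩ := h
  obtain ⟨o, ho⟩ := hu.exists_owner
  have hm : ∀ i, (u i).card = m := fun i => by rw [hu.1 i, hN, Nat.mul_div_cancel_left m hK]
  refine le_trans ?_ hR
  rw [sum_graphClass_div_card hm0 hu hm, le_div_iff₀ (by exact_mod_cast K.factorial_pos)]
  have hle : ∀ τ, ((neededBits o Z τ).card : ℝ) / B ≤ r (cycleAlong u τ) := by
    intro τ
    have hmem : cycleAlong u τ ∈ graphClass u (cyclicShuffle u) := by
      rw [← mem_coe, graphClass_cyclicShuffle hu hm]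
      exact ⟨τ, rfl⟩
    obtain ⟨q, φ, hφ, hq⟩ := hr _ hmem
    exact (card_neededBits_le_load ho hφ).trans hq
  have hB0 : (0 : ℝ) < B := by exact_mod_cast hB
  calc (m : ℝ) * ((K : ℝ) - s) / s * K.factorial =
        (K.factorial : ℝ) * (m * B * ((K : ℝ) - s) / s) / B := by field_simp
    _ ≤ (∑ τ, ((neededBits o Z τ).card : ℝ)) / B := by
        gcongr
        exact le_sum_card_neededBits hK hN hs ho hZ
    _ = ∑ τ, ((neededBits o Z τ).card : ℝ) / B := sum_div _ _ _
    _ ≤ _ := sum_le_sum fun τ _ => hle τ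

end Converse

/-! ### Comparison of the three notions and the closed form -/

theorem PerpetuallyAchievable.worstCase {N K S : ℕ} {u : Fin K → Finset (Fin N)} {R : ℝ}
    (h : PerpetuallyAchievable S u R) : WorstCaseAchievable S u R := by
  obtain ⟨B, hB, A, ⟨Z, hZ⟩, hA⟩ := h
  refine ⟨B, hB, Z, (hA u Z hZ).1, fun d hd => ?_⟩
  obtain ⟨q, φ, hφ, hq, -⟩ := (hA u Z hZ).2 d hd
  exact ⟨q, φ, hφ, hq⟩

theorem WorstCaseAchievable.average {N K S : ℕ} {u e : Fin K → Finset (Fin N)}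
    (he : IsAssignment e) {R : ℝ} (h : WorstCaseAchievable S u R) : AverageAchievable S u e R := by
  obtain ⟨B, hB, Z, hZ, hd⟩ := h
  refine ⟨B, hB, Z, hZ, fun _ => R, fun d hmem => hd d ?_, ?_⟩
  · simp only [graphClass, mem_filter] at hmem
    exact hmem.2.1
  · have hpos : 0 < (graphClass u e).card := by
      refine card_pos.2 ⟨e, ?_⟩
      simp only [graphClass, mem_filter, mem_univ, true_and]
      exact ⟨he, 1, fun _ _ => rfl⟩
    have hpos' : ((graphClass u e).card : ℝ) ≠ 0 := by exact_mod_cast hpos.ne'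
    rw [sum_const, nsmul_eq_mul, mul_div_cancel_left₀ _ hpos']

theorem optimalLoad_eq {K m s : ℕ} (hK : 0 < K) (hm0 : 0 < m) :
    optimalLoad (K * m) K (m * s) =
      (m : ℝ) * ((K - 1).choose s : ℝ) / ((K - 1).choose (s - 1) : ℝ) := by
  have hK0 : (K : ℝ) ≠ 0 := by exact_mod_cast hK.ne'
  rw [optimalLoad, Nat.mul_div_cancel_left m hK, Nat.mul_div_cancel_left s hm0, Nat.cast_mul,
    mul_div_cancel_left₀ _ hK0]

theorem mul_choose_div_choose {K s : ℕ} (m : ℝ) (hs : 1 ≤ s) (hsK : s ≤ K) :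
    m * ((K - 1).choose s : ℝ) / ((K - 1).choose (s - 1) : ℝ) = m * ((K : ℝ) - s) / s := by
  have h := Nat.choose_succ_right_eq (K - 1) (s - 1)
  rw [Nat.sub_add_cancel hs, show K - 1 - (s - 1) = K - s by omega] at h
  have h' : ((K - 1).choose s : ℝ) * s = (K - 1).choose (s - 1) * ((K : ℝ) - s) := by
    rw [← Nat.cast_sub hsK]
    exact_mod_cast h
  have hpos : (0 : ℝ) < (K - 1).choose (s - 1) := by
    exact_mod_cast Nat.choose_pos (by omega)
  have hs0 : (0 : ℝ) < s := by exact_mod_cast hs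
  rw [div_eq_div_iff hpos.ne' hs0.ne', mul_assoc, h']
  ring

end DataShuffling

theorem theorem5 (N K S : ℕ) (hK : 0 < K) (hKN : K ≤ N) (hdvd : K ∣ N)
    (hSdvd : N / K ∣ S) (hS1 : N / K ≤ S) (hS2 : S ≤ N)
    (u : Fin K → Finset (Fin N)) (hu : DataShuffling.IsAssignment u) :
    IsLeast {R : ℝ | DataShuffling.WorstCaseAchievable S u R}
        (DataShuffling.optimalLoad N K S) ∧
      IsLeast {R : ℝ | DataShuffling.PerpetuallyAchievable S u R}
        (DataShuffling.optimalLoad N K S) ∧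
      IsLeast {R : ℝ | DataShuffling.AverageAchievable S u (DataShuffling.cyclicShuffle u) R}
        (DataShuffling.optimalLoad N K S) := by
  obtain ⟨m, hN⟩ := hdvd
  have hNK : N / K = m := by rw [hN, Nat.mul_div_cancel_left m hK]
  have hm0 : 0 < m := Nat.pos_of_mul_pos_left (hN ▸ hK.trans_le hKN)
  rw [hNK] at hSdvd hS1
  obtain ⟨s, rfl⟩ := hSdvd
  have hs : 1 ≤ s := Nat.pos_of_mul_pos_left (hm0.trans_le hS1)
  have hsK : s ≤ K := by
    rw [hN, mul_comm K m] at hS2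
    exact Nat.le_of_mul_le_mul_left hS2 hm0
  have hload := DataShuffling.optimalLoad_eq (s := s) hK hm0
  rw [← hN] at hload
  have hperp := DataShuffling.perpetuallyAchievable hK hN hs hsK hu
  rw [← hload] at hperp
  have he : DataShuffling.IsAssignment (DataShuffling.cyclicShuffle u) :=
    DataShuffling.isAssignment_cycleAlong hu 1
  have hlower : ∀ R, DataShuffling.AverageAchievable (m * s) u (DataShuffling.cyclicShuffle u) R →
      DataShuffling.optimalLoad N K (m * s) ≤ R := fun R hR => by
    rw [hload, DataShuffling.mul_choose_div_choose _ hs hsK]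
    exact hR.le hK hm0 hN hs hu
  exact ⟨⟨hperp.worstCase, fun R hR => hlower R (hR.average he)⟩,
    ⟨hperp, fun R hR => hlower R (hR.worstCase.average he)⟩,
    ⟨hperp.worstCase.average he, hlower⟩⟩
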